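/- Let $m \geq 1$ be an integer and let $k$ be a commutative Noetherian ring. Let $\mathrm{FI}^m$ be the category whose objects are $m$-tuples $(T_1,\dots,T_m)$ of finite sets and whose morphisms $(T_1,\dots,T_m)\to(T_1',\dots,T_m')$ are $m$-tuples $(f_1,\dots,f_m)$ of injective maps $f_i\colon T_i\to T_i'$, and let $\mathcal C$ be its full subcategory on the objects $([n_1],\dots,[n_m])$ with $n_i\in\mathbb N$, where $[n]=\{1,\dots,n\}$ and $[0]=\emptyset$. For $\mathcal D\in\{\mathrm{FI}^m,\mathcal C\}$, a $\mathcal D$-module is a covariant functor $V$ from $\mathcal D$ to the category of $k$-modules; a submodule of $V$ is a family of $k$-submodules of the values of $V$ at the objects of $\mathcal D$ that is stable under all morphisms of $\mathcal D$; and $V$ is finitely generated if there is a finite set $S$ of elements of the values of $V$ such that every submodule of $V$ containing $S$ equals $V$. Then $\mathrm{FI}^m$ and $\mathcal C$ are locally Noetherian over $k$: every submodule of a finitely generated $\mathrm{FI}^m$-module is finitely generated, and every submodule of a finitely generated $\mathcal C$-module is finitely generated. -/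

import Mathlib

open CategoryTheory

universe w v u

/-- An object of the category `FI`: a finite set. -/
structure FI : Type (w + 1) where
  /-- the underlying set -/
  carrier : Type w
  [finite : Finite carrier]

/-- The category `FI`: morphisms are the injective maps. -/
instance FI.category : Category.{w} FI.{w} where
  Hom S T := S.carrier ↪ T.carrier
  id S := Function.Embedding.refl S.carrier
  comp f g := Function.Embedding.trans f g

/-- The category `FI^m`: objects are `m`-tuples of finite sets, morphisms are `m`-tuples of
injections (this is the product category of `m` copies of `FI`). -/
abbrev FIPower (m : ℕ) : Type (w + 1) := Fin m → FI.{w}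

/-- The object `([n₁], …, [n_m])` of `FI^m`. -/
def FIPower.standard {m : ℕ} (n : Fin m → ℕ) : FIPower.{0} m := fun i => ⟨Fin (n i)⟩

/-- The full subcategory of `FI^m` on the objects `([n₁], …, [n_m])`, whose objects are
identified with the elements `n` of `ℕ^m`. -/
abbrev FIPowerSkeleton (m : ℕ) : Type :=
  InducedCategory (FIPower.{0} m) (FIPower.standard (m := m))

/-- A `C`-module over `k`: a covariant functor from `C` to `k`-modules. -/
abbrev CatModule (C : Type*) [Category C] (k : Type u) [CommRing k] := C ⥤ ModuleCat.{v} k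

namespace CatModule

variable {C : Type*} [Category C] {k : Type u} [CommRing k]

/-- A submodule of a `C`-module `V`: a submodule of each value `V_X`, such that the family is
stable under all morphisms of `C`. -/
structure Sub (V : CatModule.{v} C k) where
  /-- the value of the submodule at an object, as a submodule of the value of `V` -/
  val (X : C) : Submodule k (V.obj X)
  map_mem {X Y : C} (f : X ⟶ Y) (x : V.obj X) (hx : x ∈ val X) : (V.map f).hom x ∈ val Y

/-- A submodule of a `C`-module is itself a `C`-module. -/
def Sub.toModule {V : CatModule.{v} C k} (N : Sub V) : CatModule.{v} C k where
  obj X := ModuleCat.of k (N.val X)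
  map {X Y} f := ModuleCat.ofHom ((V.map f).hom.restrict (N.map_mem f))
  map_id X := by
    ext x
    simp
  map_comp f g := by
    ext x
    simp

/-- `V` is finitely generated: there is a finite set `S` of elements of `V` such that every
submodule of `V` that contains `S` coincides with `V`. -/
def IsFinitelyGenerated (V : CatModule.{v} C k) : Prop :=
  ∃ S : Finset (Σ X : C, V.obj X),
    ∀ N : Sub V, (∀ s ∈ S, s.2 ∈ N.val s.1) → ∀ X : C, N.val X = ⊤

end CatModule

/-- `C` is locally Noetherian over `k`: every submodule of a finitely generated `C`-module over `k`
is finitely generated. -/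
def IsLocallyNoetherianOver.{v', u', a, b} (C : Type a) [Category.{b} C]
    (k : Type u') [CommRing k] : Prop :=
  ∀ V : CatModule.{v'} C k, V.IsFinitelyGenerated →
    ∀ N : CatModule.Sub V, N.toModule.IsFinitelyGenerated

/-! The proof is a Gröbner basis argument. A module generated by a finite set `S` is, at each
object, a quotient of a sum over `S` of free modules on Hom-sets. Automorphisms rule out an
invariant monomial order, so only the action of order embeddings is kept (`OIPower`). This loses
nothing, as every object is isomorphic to one coming from there, and finite generation under fewer
morphisms is stronger.

Order embeddings preserve the lexicographic order on maps into ordered sets. A map into an ordered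
finite set is the word of its fibres, and deleting letters from the word undoes postcomposition with
an order embedding. Higman's lemma, with finite products of well quasi-orders, thus makes
divisibility of monomials a well quasi-order. Leading ideals grow along divisibility, so the
ascending chain condition in `k` leaves finitely many monomials to consider
(`exists_finset_of_stable`). -/

/-! ### Well quasi-orders -/

/-- Every element lies above one of finitely many elements, for a well quasi-order. -/
theorem WellQuasiOrdered.exists_finset {α : Type*} {r : α → α → Prop} (hr : WellQuasiOrdered r) :
    ∃ F : Finset α, ∀ a, ∃ b ∈ F, r b a := by
  by_contra! h
  obtain ⟨f, -, hf⟩ := exists_seq_of_forall_finset_exists (fun _ : α => True) (fun b a => ¬ r b a)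
    (fun F _ => (h F).imp fun a ha => ⟨trivial, ha⟩)
  obtain ⟨i, j, hij, hr⟩ := hr f
  exact hf i j hij hr

/-- A well quasi-order stays one if a monotone map to an order with the ascending chain condition
is required to be constant along the relation. -/
theorem WellQuasiOrdered.and_eq_of_monotone {α β : Type*} {r : α → α → Prop} [IsPreorder α r]
    (hr : WellQuasiOrdered r) [PartialOrder β] [WellFoundedGT β] (L : α → β)
    (hL : ∀ a b, r a b → L a ≤ L b) : WellQuasiOrdered fun a b => r a b ∧ L a = L b := by
  intro f
  obtain ⟨g, hg⟩ := hr.exists_monotone_subseq f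
  obtain ⟨n, hn⟩ := WellFoundedGT.monotone_chain_condition
    (⟨fun i => L (f (g i)), fun i j hij => hL _ _ (hg i j hij)⟩ : ℕ →o β)
  exact ⟨g n, g (n + 1), g.strictMono n.lt_succ_self, hg _ _ n.le_succ, hn _ n.le_succ⟩

/-- **Higman's lemma** for words over a finite alphabet. -/
theorem List.wellQuasiOrdered_sublist (A : Type*) [Finite A] :
    WellQuasiOrdered (List.Sublist : List A → List A → Prop) := by
  have h := Set.PartiallyWellOrderedOn.partiallyWellOrderedOn_sublistForall₂ (Eq : A → A → Prop)
    (s := Set.univ) (Set.partiallyWellOrderedOn_univ_iff.2 (Finite.wellQuasiOrdered _))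
  intro f
  obtain ⟨i, j, hij, hf⟩ := h.exists_lt (f := f) (fun _ _ _ => Set.mem_univ _)
  obtain ⟨l, hl, hl'⟩ := List.sublistForall₂_iff.1 hf
  rw [List.forall₂_eq_eq_eq] at hl
  exact ⟨i, j, hij, hl ▸ hl'⟩

/-! ### Leading ideals -/

section LeadingIdeal

variable {k : Type u} [CommRing k] {B : Type*} [LinearOrder B]

/-- The ideal of the leading coefficients at `b` of a submodule of a free module on an ordered
basis. -/
noncomputable def leadingIdeal (M : Submodule k (B →₀ k)) (b : B) : Ideal k :=
  (M ⊓ Finsupp.supported k k (Set.Iic b)).map (Finsupp.lapply b)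

theorem mem_leadingIdeal {M : Submodule k (B →₀ k)} {b : B} {c : k} :
    c ∈ leadingIdeal M b ↔ ∃ x ∈ M, x ∈ Finsupp.supported k k (Set.Iic b) ∧ x b = c := by
  simp [leadingIdeal, and_assoc]

/-- A nonzero element has a leading term. -/
theorem Finsupp.exists_mem_supported_Iic {x : B →₀ k} (hx : x ≠ 0) :
    ∃ b, x b ≠ 0 ∧ x ∈ Finsupp.supported k k (Set.Iic b) := by
  have hs : x.support.Nonempty := Finsupp.support_nonempty_iff.2 hx
  refine ⟨x.support.max' hs, Finsupp.mem_support_iff.1 (x.support.max'_mem hs), ?_⟩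
  exact (Finsupp.mem_supported k x).2 fun b hb => x.support.le_max' b hb

/-- A submodule is determined by its leading ideals. -/
theorem le_of_leadingIdeal_le [WellFoundedLT B] {M M' : Submodule k (B →₀ k)} (hle : M' ≤ M)
    (h : ∀ b, leadingIdeal M b ≤ leadingIdeal M' b) : M ≤ M' := by
  -- Division algorithm: subtracting an element of `M'` with the same leading coefficient lowers the
  -- leading index, which ends by well-foundedness.
  have key : ∀ b, ∀ x ∈ M, x ∈ Finsupp.supported k k (Set.Iic b) → x ∈ M' := by
    intro b
    induction b using WellFoundedLT.induction with
    | ind b ih =>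
    intro x hx hxb
    obtain ⟨y, hy, hyb, hxy⟩ := mem_leadingIdeal.1 (h b (mem_leadingIdeal.2 ⟨x, hx, hxb, rfl⟩))
    suffices x - y ∈ M' by simpa using add_mem this hy
    by_cases h0 : x - y = 0
    · rw [h0]; exact zero_mem _
    obtain ⟨c, hc, hcs⟩ := Finsupp.exists_mem_supported_Iic h0
    have hcb : c ≤ b :=
      (Finsupp.mem_supported k _).1 (sub_mem hxb hyb) (Finsupp.mem_support_iff.2 hc)
    have hne : c ≠ b := by
      rintro rfl
      exact hc (by simp [hxy])
    exact ih c (lt_of_le_of_ne hcb hne) _ (sub_mem hx (hle hy)) hcs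
  intro x hx
  by_cases h0 : x = 0
  · rw [h0]; exact zero_mem _
  obtain ⟨b, -, hb⟩ := Finsupp.exists_mem_supported_Iic h0
  exact key b x hx hb

/-- Leading ideals grow along strictly monotone maps of the bases. -/
theorem leadingIdeal_le_of_strictMono {B' : Type*} [LinearOrder B'] {φ : B → B'}
    (hφ : StrictMono φ) {M : Submodule k (B →₀ k)} {M' : Submodule k (B' →₀ k)}
    (h : ∀ x ∈ M, x.mapDomain φ ∈ M') (b : B) :
    leadingIdeal M b ≤ leadingIdeal M' (φ b) := by
  classical
  intro c hc
  obtain ⟨x, hx, hxb, rfl⟩ := mem_leadingIdeal.1 hc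
  refine mem_leadingIdeal.2 ⟨x.mapDomain φ, h x hx, ?_, Finsupp.mapDomain_apply hφ.injective x b⟩
  refine (Finsupp.mem_supported k _).2 fun d hd => ?_
  obtain ⟨a, ha, rfl⟩ := Finset.mem_image.1 (Finsupp.mapDomain_support hd)
  exact hφ.monotone ((Finsupp.mem_supported k x).1 hxb ha)

/-- Over a Noetherian ring, finitely many elements of `M` produce all leading coefficients at
`b`. -/
theorem exists_finset_leadingIdeal_le [IsNoetherianRing k] (M : Submodule k (B →₀ k)) (b : B) :
    ∃ T : Finset (B →₀ k), (∀ x ∈ T, x ∈ M) ∧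
      ∀ M' : Submodule k (B →₀ k), (∀ x ∈ T, x ∈ M') → leadingIdeal M b ≤ leadingIdeal M' b := by
  classical
  obtain ⟨C, hC⟩ := IsNoetherian.noetherian (leadingIdeal M b)
  have hsub : (C : Set k) ⊆ Finsupp.lapply (R := k) b ''
      (M ⊓ Finsupp.supported k k (Set.Iic b) : Submodule k (B →₀ k)) := by
    intro c hc
    have : c ∈ leadingIdeal M b := hC ▸ Submodule.subset_span hc
    exact this
  obtain ⟨T, hT, rfl⟩ := Finset.subset_set_image_iff.1 hsub
  refine ⟨T, fun x hx => (hT hx).1, fun M' hM' => ?_⟩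
  rw [← hC, Submodule.span_le]
  intro c hc
  obtain ⟨x, hx, rfl⟩ := Finset.mem_image.1 (Finset.mem_coe.1 hc)
  exact mem_leadingIdeal.2 ⟨x, hM' x hx, (hT hx).2, rfl⟩

end LeadingIdeal

/-- **Hilbert's basis theorem** for families of submodules of free modules which are stable under
strictly monotone maps of the bases, when the bases are jointly well quasi-ordered by the maps. -/
theorem exists_finset_of_stable {k : Type u} [CommRing k] [IsNoetherianRing k]
    {O : Type*} [Category O] {B : O → Type*} [∀ n, LinearOrder (B n)] [∀ n, WellFoundedLT (B n)]
    (act : ∀ {a b : O}, (a ⟶ b) → B a → B b) (act_id : ∀ a (x : B a), act (𝟙 a) x = x)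
    (act_comp : ∀ {a b c : O} (f : a ⟶ b) (g : b ⟶ c) (x : B a), act (f ≫ g) x = act g (act f x))
    (act_mono : ∀ {a b : O} (f : a ⟶ b), StrictMono (act f))
    (wqo : WellQuasiOrdered fun p q : Σ n, B n => ∃ h : p.1 ⟶ q.1, act h p.2 = q.2)
    (M : ∀ n, Submodule k (B n →₀ k))
    (hM : ∀ {a b : O} (h : a ⟶ b), ∀ x ∈ M a, x.mapDomain (act h) ∈ M b) :
    ∃ T : Finset (Σ n, B n →₀ k), (∀ t ∈ T, t.2 ∈ M t.1) ∧
      ∀ M' : ∀ n, Submodule k (B n →₀ k),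
        (∀ {a b : O} (h : a ⟶ b), ∀ x ∈ M' a, x.mapDomain (act h) ∈ M' b) →
        (∀ n, M' n ≤ M n) → (∀ t ∈ T, t.2 ∈ M' t.1) → ∀ n, M n ≤ M' n := by
  classical
  have : IsPreorder (Σ n, B n) fun p q => ∃ h : p.1 ⟶ q.1, act h p.2 = q.2 :=
    { refl := fun p => ⟨𝟙 _, act_id _ _⟩
      trans := by
        rintro p q r ⟨f, hf⟩ ⟨g, hg⟩
        exact ⟨f ≫ g, by rw [act_comp, hf, hg]⟩ }
  -- Noetherianity of `k` enters here: every monomial is divisible by one of finitely many with the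
  -- same leading ideal.
  have wqo' := wqo.and_eq_of_monotone (fun p => leadingIdeal (M p.1) p.2) (by
    rintro ⟨a, x⟩ ⟨b, y⟩ ⟨f, hf⟩
    dsimp only at f hf
    subst hf
    exact leadingIdeal_le_of_strictMono (act_mono f) (hM f) x)
  obtain ⟨F, hF⟩ := wqo'.exists_finset
  choose T hTM hT using fun p : Σ n, B n => exists_finset_leadingIdeal_le (M p.1) p.2
  refine ⟨F.biUnion fun p => (T p).image (Sigma.mk p.1), ?_, ?_⟩
  · intro t ht
    simp only [Finset.mem_biUnion, Finset.mem_image] at ht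
    obtain ⟨p, -, x, hx, rfl⟩ := ht
    exact hTM p x hx
  · intro M' hM' hle hTM' n
    refine le_of_leadingIdeal_le (hle n) fun b => ?_
    obtain ⟨p, hp, ⟨f, hf⟩, hL⟩ := hF ⟨n, b⟩
    dsimp only at f hf hL
    -- At the chosen divisor `p` of `b`, the leading ideal of `M` is already that at `b`; `T p` puts
    -- it into that of `M'` at `p`, and `f` carries it to `b`.
    rw [← hL, ← hf]
    refine (hT p (M' p.1) fun x hx => ?_).trans
      (leadingIdeal_le_of_strictMono (act_mono f) (hM' f) p.2)
    exact hTM' ⟨p.1, x⟩ (Finset.mem_biUnion.2 ⟨p, hp, Finset.mem_image_of_mem _ hx⟩)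

/-! ### A criterion for local Noetherianity -/

namespace CatModule

variable {C : Type*} [Category C] {k : Type u} [CommRing k]

/-- The submodule generated by a set of elements. -/
def Sub.span {V : CatModule.{v} C k} (S : Set (Σ X : C, V.obj X)) : Sub V where
  val Y := Submodule.span k
    (Set.range fun p : Σ s : S, (s.1.1 ⟶ Y) => (V.map p.2).hom p.1.1.2)
  map_mem {Y Z} f x hx := by
    induction hx using Submodule.span_induction with
    | mem x hx =>
      obtain ⟨⟨s, g⟩, rfl⟩ := hx
      exact Submodule.subset_span ⟨⟨s, g ≫ f⟩, by simp⟩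
    | zero => simp
    | add x y _ _ hx hy => rw [map_add]; exact add_mem hx hy
    | smul a x _ hx => rw [map_smul]; exact Submodule.smul_mem _ a hx

theorem Sub.mem_span {V : CatModule.{v} C k} {S : Set (Σ X : C, V.obj X)} {s : Σ X : C, V.obj X}
    (hs : s ∈ S) : s.2 ∈ (Sub.span S).val s.1 :=
  Submodule.subset_span ⟨⟨⟨s, hs⟩, 𝟙 _⟩, by simp⟩

end CatModule

/-- A category `D` is locally Noetherian over every Noetherian ring if it admits an essentially
surjective functor `Φ : O ⥤ D` and compatible orders on the sets `X ⟶ Φ.obj n` which make these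
sets, for fixed `X`, suitable for Gröbner bases: `O` acts by strictly monotone maps, and the
divisibility relation is a well quasi-order. -/
theorem isLocallyNoetherianOver_of_functor {k : Type u} [CommRing k] [IsNoetherianRing k]
    {O : Type*} [Category O] {D : Type*} [Category D] (Φ : O ⥤ D) [Φ.EssSurj]
    [∀ X n, LinearOrder (X ⟶ Φ.obj n)] [∀ X n, Finite (X ⟶ Φ.obj n)]
    (mono : ∀ (X : D) {a b : O} (h : a ⟶ b), StrictMono fun f : X ⟶ Φ.obj a => f ≫ Φ.map h)
    (wqo : ∀ X : D, WellQuasiOrdered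
      fun p q : Σ n, (X ⟶ Φ.obj n) => ∃ h : p.1 ⟶ q.1, p.2 ≫ Φ.map h = q.2) :
    IsLocallyNoetherianOver.{v} D k := by
  classical
  rintro V ⟨S, hS⟩ N
  -- Any order on the generators will do: postcomposition fixes the generator, which is compared
  -- first.
  let : LinearOrder S := IsWellOrder.linearOrder WellOrderingRel
  let B : O → Type _ := fun n => Σₗ s : S, (s.1.1 ⟶ Φ.obj n)
  have : ∀ n, Finite (B n) := fun n =>
    inferInstanceAs (Finite (Σ s : S, (s.1.1 ⟶ Φ.obj n)))
  let act : ∀ {a b : O}, (a ⟶ b) → B a → B b := fun h p => ⟨p.1, p.2 ≫ Φ.map h⟩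
  have act_mono : ∀ {a b : O} (h : a ⟶ b), StrictMono (act h) := by
    intro a b h p q hpq
    rw [Sigma.Lex.lt_def] at hpq ⊢
    obtain hlt | ⟨he, hlt⟩ := hpq
    · exact Or.inl hlt
    · obtain ⟨s, f⟩ := p
      obtain ⟨t, g⟩ := q
      dsimp only at he
      subst he
      exact Or.inr ⟨rfl, mono _ h hlt⟩
  have act_wqo : WellQuasiOrdered fun p q : Σ n, B n => ∃ h : p.1 ⟶ q.1, act h p.2 = q.2 := by
    intro f
    -- As `S` is finite, some subsequence has a constant generator, and `wqo` for that single source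
    -- applies.
    obtain ⟨g, hg⟩ := (Finite.wellQuasiOrdered (Eq : S → S → Prop)).exists_monotone_subseq
      (fun i => (f i).2.1)
    have hB : ∀ (n : O) (p : B n) (s : S), s = p.1 →
        ∃ φ : s.1.1 ⟶ Φ.obj n, p = ⟨s, φ⟩ := by
      rintro n ⟨s, φ⟩ _ rfl
      exact ⟨φ, rfl⟩
    choose φ hφ using fun i => hB _ (f (g i)).2 (f (g 0)).2.1 (hg 0 i i.zero_le)
    obtain ⟨i, j, hij, h, hh⟩ := wqo _ fun i => (⟨(f (g i)).1, φ i⟩ : Σ n, (_ ⟶ Φ.obj n))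
    refine ⟨g i, g j, g.strictMono hij, h, ?_⟩
    rw [hφ i, hφ j]
    exact congrArg (Sigma.mk _) hh
  let π : ∀ n, (B n →₀ k) →ₗ[k] V.obj (Φ.obj n) := fun n =>
    Finsupp.linearCombination k fun p : B n => (V.map p.2).hom p.1.1.2
  have π_surj : ∀ n, Function.Surjective (π n) := by
    intro n
    rw [← LinearMap.range_eq_top, Finsupp.range_linearCombination]
    exact hS (CatModule.Sub.span (S : Set (Σ X : D, V.obj X)))
      (fun s hs => CatModule.Sub.mem_span hs) _
  have π_act : ∀ {a b : O} (h : a ⟶ b) (x : B a →₀ k),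
      π b (x.mapDomain (act h)) = (V.map (Φ.map h)).hom (π a x) := by
    intro a b h x
    induction x using Finsupp.induction_linear with
    | zero => simp
    | add x y hx hy => rw [Finsupp.mapDomain_add, map_add, map_add, map_add, hx, hy]
    | single p c =>
      rw [Finsupp.mapDomain_single, Finsupp.linearCombination_single,
        Finsupp.linearCombination_single, map_smul, Functor.map_comp, ModuleCat.hom_comp,
        LinearMap.comp_apply]
  obtain ⟨T, hTM, hT⟩ := exists_finset_of_stable (k := k) act
    (fun a x => Sigma.ext rfl (heq_of_eq (by simp [act])))
    (fun f g x => Sigma.ext rfl (heq_of_eq (by simp [act]))) act_mono act_wqo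
    (fun n => (N.val (Φ.obj n)).comap (π n))
    (fun h x hx => by
      rw [Submodule.mem_comap, π_act]
      exact N.map_mem _ _ hx)
  refine ⟨T.attach.image fun t => ⟨Φ.obj t.1.1, ⟨π t.1.1 t.1.2, hTM t.1 t.2⟩⟩, fun N' hN' => ?_⟩
  have htop : ∀ n, N'.val (Φ.obj n) = ⊤ := by
    intro n
    -- `N'` lives inside `N`; its image in `V` is pulled back along `π` to be compared with the
    -- pullback of `N`.
    have hle := hT
      (fun n => ((N'.val (Φ.obj n)).map (N.val (Φ.obj n)).subtype).comap (π n)) ?_ ?_ ?_ n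
    · rw [eq_top_iff]
      rintro ⟨y, hy⟩ -
      obtain ⟨x, rfl⟩ := π_surj n y
      obtain ⟨z, hz, hzx⟩ := hle hy
      have : z = ⟨π n x, hy⟩ := Subtype.ext hzx
      exact this ▸ hz
    · rintro a b h x ⟨z, hz, hzx⟩
      refine ⟨_, N'.map_mem (Φ.map h) z hz, ?_⟩
      rw [π_act, ← hzx]
      rfl
    · rintro n x ⟨z, -, hzx⟩
      exact Submodule.mem_comap.2 (hzx ▸ z.2)
    · intro t ht
      exact ⟨_, hN' _ (Finset.mem_image.2 ⟨⟨t, ht⟩, Finset.mem_attach _ _, rfl⟩), rfl⟩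
  -- An arbitrary `X` is isomorphic to some `Φ.obj n`, so `x` is moved there and back.
  intro X
  rw [eq_top_iff]
  intro x _
  have hx := N'.map_mem (Φ.objObjPreimageIso X).hom ((N.toModule.map
    (Φ.objObjPreimageIso X).inv).hom x) (by rw [htop]; trivial)
  rwa [← ModuleCat.comp_apply, ← Functor.map_comp, Iso.inv_hom_id,
    CategoryTheory.Functor.map_id] at hx

/-! ### Tuples of ordered finite sets -/

/-- The category of the ordered sets `{0, …, n - 1}` and their order embeddings. -/
structure OI where
  /-- the cardinality of the ordered set -/
  card : ℕ

instance OI.category : Category OI where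
  Hom a b := Fin a.card ↪o Fin b.card
  id a := RelEmbedding.refl _
  comp f g := RelEmbedding.trans f g

/-- The category of `m`-tuples of finite ordered sets. -/
abbrev OIPower (m : ℕ) : Type := Fin m → OI

/-- A category over which tuples of finite ordered sets lie essentially surjectively, and whose
morphisms to such tuples are determined by families of maps of finite sets, is locally
Noetherian. -/
theorem isLocallyNoetherianOver_of_coordinates {k : Type u} [CommRing k] [IsNoetherianRing k]
    {m : ℕ} {D : Type*} [Category D] (Φ : OIPower m ⥤ D) [Φ.EssSurj]
    (P : D → Fin m → Type*) [∀ X i, Finite (P X i)]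
    (ev : ∀ {X : D} {n : OIPower m}, (X ⟶ Φ.obj n) → ∀ i, P X i → Fin (n i).card)
    (ev_injective : ∀ (X : D) (n : OIPower m), Function.Injective (ev (X := X) (n := n)))
    (ev_comp : ∀ {X : D} {a b : OIPower m} (f : X ⟶ Φ.obj a) (h : a ⟶ b) (i : Fin m) (x : P X i),
      ev (f ≫ Φ.map h) i x = (show Fin (a i).card ↪o Fin (b i).card from h i) (ev f i x)) :
    IsLocallyNoetherianOver.{v} D k := by
  let e : ∀ X : D, (Σ i, P X i) ≃ Fin (Nat.card (Σ i, P X i)) := fun X => Finite.equivFin _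
  -- The list of all values in a fixed enumeration of the points. An order embedding preserves the
  -- first place where two lists differ and the comparison there.
  let key : ∀ {X : D} {n : OIPower m}, (X ⟶ Φ.obj n) → Lex (Fin (Nat.card (Σ i, P X i)) → ℕ) :=
    fun {X n} f => toLex fun j => (ev f ((e X).symm j).1 ((e X).symm j).2 : ℕ)
  have key_injective : ∀ (X : D) (n : OIPower m), Function.Injective (key (X := X) (n := n)) := by
    intro X n f g hfg
    refine ev_injective X n (funext fun i => funext fun x => Fin.ext ?_)
    have h : ∀ p : Σ i, P X i, (ev f p.1 p.2 : ℕ) = ev g p.1 p.2 :=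
      (e X).symm.surjective.forall.2 (congrFun (toLex_inj.1 hfg))
    exact h ⟨i, x⟩
  let : ∀ X n, LinearOrder (X ⟶ Φ.obj n) := fun X n => LinearOrder.lift' key (key_injective X n)
  have : ∀ X n, Finite (X ⟶ Φ.obj n) := fun X n => Finite.of_injective _ (ev_injective X n)
  refine isLocallyNoetherianOver_of_functor Φ ?_ ?_
  · intro X a b h f g hfg
    obtain ⟨j, hj, hlt⟩ : key f < key g := hfg
    refine (show key (f ≫ Φ.map h) < key (g ≫ Φ.map h) from ⟨j, fun i hi => ?_, ?_⟩)
    · have hi' := Fin.ext (hj i hi)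
      change ((ev (f ≫ Φ.map h) _ _ : Fin _) : ℕ) = ev (g ≫ Φ.map h) _ _
      rw [ev_comp, ev_comp, hi']
    · change ((ev (f ≫ Φ.map h) _ _ : Fin _) : ℕ) < ev (g ≫ Φ.map h) _ _
      rw [ev_comp, ev_comp]
      exact (show Fin (a _).card ↪o Fin (b _).card from h _).strictMono (Fin.lt_def.2 hlt)
  · intro X f
    have : ∀ i, IsPreorder (List (Set (P X i))) List.Sublist := fun i =>
      { refl := List.Sublist.refl
        trans := fun _ _ _ => List.Sublist.trans }
    have hpi := WellQuasiOrdered.pi fun i => List.wellQuasiOrdered_sublist (Set (P X i))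
    -- Letter `j` of the word is the fibre over `j`, possibly empty; a sublist embedding of words is
    -- an order embedding `g` matching the fibres.
    obtain ⟨a, b, hab, h⟩ := hpi fun l i =>
      List.ofFn fun j : Fin ((f l).1 i).card => {x | ev (f l).2 i x = j}
    refine ⟨a, b, hab, ?_⟩
    have hemb : ∀ i, ∃ g : Fin ((f a).1 i).card ↪o Fin ((f b).1 i).card,
        ∀ j, {x | ev (f a).2 i x = j} = {x | ev (f b).2 i x = g j} := by
      intro i
      obtain ⟨g, hg⟩ := List.sublist_iff_exists_fin_orderEmbedding_get_eq.1 (h i)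
      refine ⟨(Fin.castOrderIso List.length_ofFn.symm).toOrderEmbedding.trans
        (g.trans (Fin.castOrderIso List.length_ofFn).toOrderEmbedding), fun j => ?_⟩
      have hj := hg (Fin.cast List.length_ofFn.symm j)
      rwa [List.get_ofFn, List.get_ofFn] at hj
    choose g hg using hemb
    refine ⟨g, ev_injective _ _ (funext fun i => funext fun x => ?_)⟩
    rw [ev_comp]
    -- A point `x` lies in the fibre over its own value, hence in the matching fibre over the image
    -- of that value under `g i`.
    exact ((Set.ext_iff.1 (hg i _) x).1 rfl).symm

/-! ### Application to `FI^m` and its skeleton -/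

/-- The functor which sends a tuple of ordered finite sets to the underlying tuple of sets. -/
def OIPower.toFIPower (m : ℕ) : OIPower m ⥤ FIPower.{w} m where
  obj n i := ⟨ULift.{w} (Fin (n i).card)⟩
  map {a b} h i := (Equiv.ulift.toEmbedding.trans
    (show Fin (a i).card ↪o Fin (b i).card from h i).toEmbedding).trans Equiv.ulift.symm.toEmbedding

/-- The functor which sends a tuple of ordered finite sets to the underlying standard tuple. -/
def OIPower.toSkeleton (m : ℕ) : OIPower m ⥤ FIPowerSkeleton m where
  obj n := fun i => (n i).card
  map {a b} h := ⟨fun i => (show Fin (a i).card ↪o Fin (b i).card from h i).toEmbedding⟩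

/-- A bijection of finite sets is an isomorphism in `FI`. -/
def FI.isoOfEquiv {S T : FI.{w}} (e : S.carrier ≃ T.carrier) : S ≅ T where
  hom := e.toEmbedding
  inv := e.symm.toEmbedding
  hom_inv_id := Function.Embedding.ext fun x => e.symm_apply_apply x
  inv_hom_id := Function.Embedding.ext fun x => e.apply_symm_apply x

instance OIPower.essSurj_toFIPower (m : ℕ) : (OIPower.toFIPower.{w} m).EssSurj where
  mem_essImage X := by
    have := fun i => (X i).finite
    exact ⟨fun i => ⟨Nat.card (X i).carrier⟩, ⟨CategoryTheory.Pi.isoMk fun i =>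
      FI.isoOfEquiv (Equiv.ulift.trans (Finite.equivFin (X i).carrier).symm)⟩⟩

instance OIPower.essSurj_toSkeleton (m : ℕ) : (OIPower.toSkeleton m).EssSurj where
  mem_essImage X := ⟨fun i => ⟨X i⟩, ⟨Iso.refl _⟩⟩

theorem theorem1p1 {k : Type u} [CommRing k] [IsNoetherianRing k] (m : ℕ) (hm : 0 < m) :
    IsLocallyNoetherianOver.{v} (FIPower.{w} m) k ∧
      IsLocallyNoetherianOver.{v} (FIPowerSkeleton m) k := by
  constructor
  · have (X : FIPower.{w} m) (i : Fin m) : Finite (X i).carrier := (X i).finite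
    exact isLocallyNoetherianOver_of_coordinates (OIPower.toFIPower.{w} m)
      (fun X i => (X i).carrier)
      (fun {X n} f i x => ((show (X i).carrier ↪ ULift (Fin (n i).card) from f i) x).down)
      (fun X n f g hfg => funext fun i => Function.Embedding.ext fun x =>
        ULift.down_injective (congrFun (congrFun hfg i) x))
      (fun f h i x => rfl)
  · exact isLocallyNoetherianOver_of_coordinates (OIPower.toSkeleton m)
      (fun X i => Fin ((show Fin m → ℕ from X) i))
      (fun {X n} f i x => (show Fin ((show Fin m → ℕ from X) i) ↪ Fin (n i).card from f.hom i) x)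
      (fun X n f g hfg => InducedCategory.hom_ext (funext fun i => Function.Embedding.ext fun x =>
        congrFun (congrFun hfg i) x))
      (fun f h i x => rfl)
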